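/- Let $t\ge 1$, let $\mathcal W_1,\dots,\mathcal W_t,\mathcal Y_1,\dots,\mathcal Y_t$ be finite alphabets, and let $q$ be a pmf on $\mathcal W_1\times\cdots\times\mathcal W_t\times\mathcal Y_1\times\cdots\times\mathcal Y_t$; write $(W_1,\dots,W_t,Y_1,\dots,Y_t)$ for random variables with pmf $q$, and put $X=(W_1,\dots,W_t)$, $\mathcal X=\mathcal W_1\times\cdots\times\mathcal W_t$. For $n\ge 1$, a code of block length $n$ consists of finite sets $\mathcal M_1,\dots,\mathcal M_t$, an encoder $f:\mathcal X^n\to\mathcal M_1\times\cdots\times\mathcal M_t$ and decoders $g_l:\mathcal M_1\times\cdots\times\mathcal M_l\times\mathcal Y_l^n\to\mathcal W_l^n$, $l=1,\dots,t$. Let $(W_{1,i},\dots,W_{t,i},Y_{1,i},\dots,Y_{t,i})$, $i=1,\dots,n$, be drawn iid according to $q$, let $X_i=(W_{1,i},\dots,W_{t,i})$, let $(M_1,\dots,M_t)=f(X_1,\dots,X_n)$, and let $(\hat W_{l,1},\dots,\hat W_{l,n})=g_l(M_1,\dots,M_l,Y_{l,1},\dots,Y_{l,n})$. The average symbol error probability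 at decoder $l$ is $P_e^l=\frac1n\sum_{i=1}^n\Pr[\hat W_{l,i}\ne W_{l,i}]$, and the rate on channel $l$ is $\kappa_l=\frac1n\log_2|\mathcal M_l|$. A tuple $(r_1,\dots,r_t)$ of non-negative reals is called $(0,\dots,0)$-admissible if for every $\epsilon>0$ there are an $n\ge1$ and a code of block length $n$ with $P_e^l\le\epsilon$ and $\kappa_l\le r_l+\epsilon$ for all $l=1,\dots,t$. Define $$R(0,\dots,0)=\min\{r\ge 0:\ (r,0,\dots,0)\text{ is }(0,\dots,0)\text{-admissible}\}.$$ If the side-information is degraded, i.e. $(W_1,\dots,W_t)\to Y_t\to Y_{t-1}\to\cdots\to Y_1$ is a Markov chain under $q$, then this minimum exists and $$R(0,\dots,0)=\sum_{l=1}^t H\big(W_l\,\big|\,W_1,\dots,W_{l-1},Y_l\big),$$ where $H$ denotes (conditional) entropy in bits. -/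

import Mathlib

noncomputable section

namespace SideInfo

/-! ### Random variables on a finite sample space `Ω` with pmf `p : Ω → ℝ` -/

open Classical in
/-- The pmf of the random variable `A` under `p`: `a ↦ Pr[A = a]`. -/
def law {Ω α : Type*} [Fintype Ω] (p : Ω → ℝ) (A : Ω → α) (a : α) : ℝ :=
  ∑ ω with A ω = a, p ω

/-- The conditional entropy `H(A | B)` in bits. -/
def condEntropy {Ω α β : Type*} [Fintype Ω] [Fintype α] [Fintype β]
    (p : Ω → ℝ) (A : Ω → α) (B : Ω → β) : ℝ :=
  -∑ a, ∑ b, law p (fun ω => (A ω, B ω)) (a, b) *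
    Real.logb 2 (law p (fun ω => (A ω, B ω)) (a, b) / law p B b)

open Classical in
/-- `A`, `B`, `C` form a Markov chain, in this order, under `p`. -/
def IsMarkov {Ω α β γ : Type*} [Fintype Ω]
    (p : Ω → ℝ) (A : Ω → α) (B : Ω → β) (C : Ω → γ) : Prop :=
  ∀ a b c, law p (fun ω => (A ω, B ω, C ω)) (a, b, c) =
    if 0 < law p B b then
      law p (fun ω => (A ω, B ω)) (a, b) * law p (fun ω => (B ω, C ω)) (b, c) / law p B b
    else 0

/-! ### Successive refinement with side-information

Decoders are indexed by `Fin t`, so decoder `l` of `1, …, t` is `l - 1 : Fin t`. The source symbol and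
the side-information symbols `(x, y_1, …, y_t)` have joint pmf `q` on `X × (∀ l, Y l)`. -/

/-- A code of block length `n`. The message set of channel `l` is a finite set of size `m l`; decoder
`l` sees the messages of the channels `k ≤ l` and its own side-information. -/
structure Code {t : ℕ} (X : Type*) (Y Xhat : Fin t → Type*) (n : ℕ) where
  m : Fin t → ℕ
  enc : (Fin n → X) → ∀ l, Fin (m l)
  dec : ∀ l, (∀ k : {k : Fin t // k ≤ l}, Fin (m k)) → (Fin n → Y l) → Fin n → Xhat l

/-- The rate on channel `l`, in bits per source symbol. -/
def Code.rate {t : ℕ} {X : Type*} {Y Xhat : Fin t → Type*} {n : ℕ}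
    (c : Code X Y Xhat n) (l : Fin t) : ℝ :=
  1 / (n : ℝ) * Real.logb 2 (c.m l)

/-- The replica that decoder `l` produces from the source block `x` and its side-information `y`. -/
def Code.replica {t : ℕ} {X : Type*} {Y Xhat : Fin t → Type*} {n : ℕ}
    (c : Code X Y Xhat n) (l : Fin t) (x : Fin n → X) (y : Fin n → Y l) : Fin n → Xhat l :=
  c.dec l (fun k => c.enc x k) y

/-- The average distortion at decoder `l` when the `n` source and side-information tuples are iid
with pmf `q`. -/
def Code.distortion {t : ℕ} {X : Type*} {Y Xhat : Fin t → Type*} {n : ℕ}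
    [Fintype X] [∀ l, Fintype (Y l)] (c : Code X Y Xhat n)
    (q : X × (∀ l, Y l) → ℝ) (δ : ∀ l, X → Xhat l → ℝ) (l : Fin t) : ℝ :=
  ∑ s : Fin n → X × (∀ l, Y l), (∏ i, q (s i)) *
    (1 / (n : ℝ) * ∑ i, δ l (s i).1
      (c.replica l (fun j => (s j).1) (fun j => (s j).2 l) i))

/-- The set of `d`-admissible rate tuples. -/
def admissibleRegion {t : ℕ} {X : Type*} {Y Xhat : Fin t → Type*}
    [Fintype X] [∀ l, Fintype (Y l)]
    (q : X × (∀ l, Y l) → ℝ) (δ : ∀ l, X → Xhat l → ℝ) (d : Fin t → ℝ) : Set (Fin t → ℝ) :=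
  {r | (∀ l, 0 ≤ r l) ∧ ∀ ε > 0, ∃ n : ℕ, 0 < n ∧ ∃ c : Code X Y Xhat n,
    (∀ l, c.distortion q δ l ≤ d l + ε) ∧ ∀ l, c.rate l ≤ r l + ε}

/-- The rates `r ≥ 0` such that `(r, 0, …, 0)` is `d`-admissible. -/
def singleChannelRates {t : ℕ} {X : Type*} {Y Xhat : Fin t → Type*}
    [Fintype X] [∀ l, Fintype (Y l)]
    (q : X × (∀ l, Y l) → ℝ) (δ : ∀ l, X → Xhat l → ℝ) (d : Fin t → ℝ) : Set ℝ :=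
  {r | 0 ≤ r ∧ (fun l : Fin t => if (l : ℕ) = 0 then r else 0) ∈ admissibleRegion q δ d}

/-- The rate-distortion function `R(d)`: the least of `singleChannelRates q δ d`. It is written as
an infimum; that the minimum is attained is part of what is claimed about it. -/
def rateDistortion {t : ℕ} {X : Type*} {Y Xhat : Fin t → Type*}
    [Fintype X] [∀ l, Fintype (Y l)]
    (q : X × (∀ l, Y l) → ℝ) (δ : ∀ l, X → Xhat l → ℝ) (d : Fin t → ℝ) : ℝ :=
  sInf (singleChannelRates q δ d)

/-- Degraded side-information: `X, Y_t, Y_{t-1}, …, Y_1` is a Markov chain under `q`, i.e. for every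
`l` the past `(X, Y_t, …, Y_{l+1})`, the present `Y_l` and the future `(Y_{l-1}, …, Y_1)` form a
Markov chain. -/
def IsDegraded {t : ℕ} {X : Type*} {Y : Fin t → Type*} [Fintype X] [∀ l, Fintype (Y l)]
    (q : X × (∀ l, Y l) → ℝ) : Prop :=
  ∀ l : Fin t, IsMarkov q
    (fun ω => (ω.1, fun k : {k : Fin t // l < k} => ω.2 k))
    (fun ω => ω.2 l)
    (fun ω => fun k : {k : Fin t // k < l} => ω.2 k)

/-! ### Private messages: `X = (W_1, …, W_t)` and decoder `l` wants `W_l` -/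

open Classical in
/-- The symbol-error distortion measure of decoder `l`. -/
def symbolError {t : ℕ} {W : Fin t → Type*} (l : Fin t) (w : ∀ k, W k) (what : W l) : ℝ :=
  if w l = what then 0 else 1

end SideInfo

end

noncomputable section

namespace SideInfo

/-! Write `h l` for the entropy of `W_l` given `W_j`, `j < l`, and `Y_l`. The sum of the `h l` is
shown to lie in `singleChannelRates` (`IsDegraded.sum_condEntropy_mem`) and to be a lower bound for
it (`IsDegraded.sum_condEntropy_le`). Degradedness enters through `IsDegraded.law_eq_mul_srcCond`:
given the earlier components, the law of `W_k` given `Y_1, …, Y_l` depends on `Y_l` alone.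

Converse, by change of measure. For a fixed message tuple the output of decoder `l` is a function of
its side-information, so a noisy version of it is a kernel guessing `W_l` from `Y_l`. Replacing the
true conditional laws by these kernels, one component after another, leaves total mass at most `1`
(`IsDegraded.sum_block_mul_prod_blockRatio_le`). Summing over all messages bounds the expected
likelihood ratio at the actual message by the number of message tuples. Taking logarithms gives a
Fano inequality with explicit error terms (`IsDegraded.le_sum_rate`), which vanish in the limit.

Achievability, by random binning. Each `W_k` is binned separately at a rate slightly above `h k`,
and all bin indices go over the first channel. Decoder `l` recovers `W_1, …, W_l` successively. The
rate for `W_k` suffices at every decoder `l ≥ k`, because the entropy only drops when `Y_k` is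
replaced by `Y_l` (`IsDegraded.condEntropy_anti`). Errors come from an atypical source block
(`exists_tail_bound`) or from a collision in a bin (`exists_binning`). -/

open Classical in
theorem law_eq_sum_ite {Ω α : Type*} [Fintype Ω] (p : Ω → ℝ) (A : Ω → α) (a : α) :
    law p A a = ∑ ω, if A ω = a then p ω else 0 := by
  rw [law, Finset.sum_filter]

theorem law_nonneg {Ω α : Type*} [Fintype Ω] {p : Ω → ℝ} (hp : ∀ ω, 0 ≤ p ω) (A : Ω → α) (a : α) :
    0 ≤ law p A a :=
  Finset.sum_nonneg fun ω _ => hp ω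

theorem law_pos {Ω α : Type*} [Fintype Ω] {p : Ω → ℝ} (hp : ∀ ω, 0 ≤ p ω) (A : Ω → α) {ω : Ω}
    (hω : 0 < p ω) : 0 < law p A (A ω) := by
  classical
  exact Finset.sum_pos' (fun ω _ => hp ω) ⟨ω, by simp, hω⟩

/-- The law only depends on the event. -/
theorem law_congr {Ω α β : Type*} [Fintype Ω] (p : Ω → ℝ) {A : Ω → α} {B : Ω → β} {a : α} {b : β}
    (h : ∀ ω, A ω = a ↔ B ω = b) : law p A a = law p B b := by
  classical
  simp only [law_eq_sum_ite]
  exact Finset.sum_congr rfl fun ω _ => if_congr (h ω) rfl rfl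

theorem law_mono {Ω α β : Type*} [Fintype Ω] {p : Ω → ℝ} (hp : ∀ ω, 0 ≤ p ω) {A : Ω → α}
    {B : Ω → β} {a : α} {b : β} (h : ∀ ω, A ω = a → B ω = b) : law p A a ≤ law p B b := by
  classical
  exact Finset.sum_le_sum_of_subset_of_nonneg
    (Finset.monotone_filter_right _ fun ω _ => h ω) fun ω _ _ => hp ω

theorem sum_law_mul {Ω α : Type*} [Fintype Ω] [Fintype α] (p : Ω → ℝ) (A : Ω → α) (g : α → ℝ) :
    ∑ a, law p A a * g a = ∑ ω, p ω * g (A ω) := by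
  classical
  simp only [law_eq_sum_ite, Finset.sum_mul]
  rw [Finset.sum_comm]
  simp

theorem sum_law_pair {Ω α β : Type*} [Fintype Ω] [Fintype α] (p : Ω → ℝ) (A : Ω → α) (B : Ω → β)
    (b : β) : ∑ a, law p (fun ω => (A ω, B ω)) (a, b) = law p B b := by
  classical
  simp only [law_eq_sum_ite, Prod.mk.injEq]
  rw [Finset.sum_comm]
  refine Finset.sum_congr rfl fun ω _ => ?_
  by_cases h : B ω = b <;> simp [h]

/-- The law of `f A` jointly with `B` is obtained by summing over the fibre of `f`. -/
theorem law_comp_pair {Ω α β γ : Type*} [Fintype Ω] [Fintype α] [DecidableEq γ] (p : Ω → ℝ)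
    (A : Ω → α) (B : Ω → β) (f : α → γ) (d : γ) (b : β) :
    law p (fun ω => (f (A ω), B ω)) (d, b) =
      ∑ a with f a = d, law p (fun ω => (A ω, B ω)) (a, b) := by
  classical
  simp only [law_eq_sum_ite, Prod.mk.injEq]
  rw [Finset.sum_comm]
  refine Finset.sum_congr rfl fun ω _ => ?_
  by_cases h : B ω = b <;> simp [h]

/-! ### Conditional probabilities, entropy as an expectation, change of measure. -/

/-- The conditional probability `Pr[A = a | B = b]`, with the value `0` if `Pr[B = b] = 0`. -/
def condProb {Ω α β : Type*} [Fintype Ω] (p : Ω → ℝ) (A : Ω → α) (B : Ω → β) (a : α) (b : β) : ℝ :=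
  law p (fun ω => (A ω, B ω)) (a, b) / law p B b

theorem condProb_nonneg {Ω α β : Type*} [Fintype Ω] {p : Ω → ℝ} (hp : ∀ ω, 0 ≤ p ω) (A : Ω → α)
    (B : Ω → β) (a : α) (b : β) : 0 ≤ condProb p A B a b :=
  div_nonneg (law_nonneg hp _ _) (law_nonneg hp _ _)

theorem condProb_le_one {Ω α β : Type*} [Fintype Ω] {p : Ω → ℝ} (hp : ∀ ω, 0 ≤ p ω) (A : Ω → α)
    (B : Ω → β) (a : α) (b : β) : condProb p A B a b ≤ 1 :=
  div_le_one_of_le₀ (law_mono hp fun _ h => (Prod.mk.inj h).2) (law_nonneg hp _ _)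

theorem condProb_pos {Ω α β : Type*} [Fintype Ω] {p : Ω → ℝ} (hp : ∀ ω, 0 ≤ p ω) (A : Ω → α)
    (B : Ω → β) {ω : Ω} (hω : 0 < p ω) : 0 < condProb p A B (A ω) (B ω) :=
  div_pos (law_pos hp (fun ω => (A ω, B ω)) hω) (law_pos hp B hω)

theorem sum_condProb_le_one {Ω α β : Type*} [Fintype Ω] [Fintype α] (p : Ω → ℝ)
    (A : Ω → α) (B : Ω → β) (b : β) : ∑ a, condProb p A B a b ≤ 1 := by
  simp only [condProb, ← Finset.sum_div, sum_law_pair]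
  exact div_self_le_one _

theorem condEntropy_eq_sum {Ω α β : Type*} [Fintype Ω] [Fintype α] [Fintype β]
    (p : Ω → ℝ) (A : Ω → α) (B : Ω → β) :
    condEntropy p A B = -∑ ω, p ω * Real.logb 2 (condProb p A B (A ω) (B ω)) := by
  rw [condEntropy, ← Fintype.sum_prod_type', ← sum_law_mul p (fun ω => (A ω, B ω))
    (fun x => Real.logb 2 (condProb p A B x.1 x.2))]
  rfl

theorem condEntropy_nonneg {Ω α β : Type*} [Fintype Ω] [Fintype α] [Fintype β] {p : Ω → ℝ}
    (hp : ∀ ω, 0 ≤ p ω) (A : Ω → α) (B : Ω → β) : 0 ≤ condEntropy p A B := by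
  rw [condEntropy_eq_sum, neg_nonneg]
  exact Finset.sum_nonpos fun ω _ => mul_nonpos_of_nonneg_of_nonpos (hp ω)
    (Real.logb_nonpos one_lt_two (condProb_nonneg hp _ _ _ _) (condProb_le_one hp _ _ _ _))

/-- Change of measure: replacing the conditional law `c` of `A` given `B` by a subprobability
kernel `k` does not increase the expectation of a nonnegative function of `B`. -/
theorem sum_mul_div_le {Ω α β : Type*} [Fintype Ω] [Fintype α] [Fintype β] {p : Ω → ℝ}
    (hp : ∀ ω, 0 ≤ p ω) (A : Ω → α) (B : Ω → β) (c k : α → β → ℝ) (g : β → ℝ)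
    (hg : ∀ b, 0 ≤ g b)
    (hc : ∀ a b, law p (fun ω => (A ω, B ω)) (a, b) = law p B b * c a b)
    (hk : ∀ a b, 0 ≤ k a b) (hk1 : ∀ b, ∑ a, k a b ≤ 1) :
    ∑ ω, p ω * (g (B ω) * (k (A ω) (B ω) / c (A ω) (B ω))) ≤ ∑ ω, p ω * g (B ω) := by
  rw [← sum_law_mul p (fun ω => (A ω, B ω)) (fun x => g x.2 * (k x.1 x.2 / c x.1 x.2)),
    ← sum_law_mul p B g, Fintype.sum_prod_type_right]
  refine Finset.sum_le_sum fun b _ => ?_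
  have hb : 0 ≤ law p B b * g b := mul_nonneg (law_nonneg hp _ _) (hg b)
  calc ∑ a, law p (fun ω => (A ω, B ω)) (a, b) * (g b * (k a b / c a b))
      ≤ ∑ a, law p B b * g b * k a b := by
        refine Finset.sum_le_sum fun a _ => ?_
        rw [hc]
        -- Where `c` vanishes the quotient is `0` and the mass of `k` is lost; this is why only an
        -- inequality holds.
        rcases eq_or_ne (c a b) 0 with h | h
        · simpa [h] using mul_nonneg hb (hk a b)
        · exact le_of_eq (by field_simp)
    _ ≤ law p B b * g b := by
        rw [← Finset.mul_sum]
        exact mul_le_of_le_one_right hb (hk1 b)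

/-! ### Blocks of independent copies -/

/-- The pmf of `n` independent copies. -/
def block {Ω : Type*} (p : Ω → ℝ) (n : ℕ) (s : Fin n → Ω) : ℝ := ∏ i, p (s i)

theorem block_nonneg {Ω : Type*} {p : Ω → ℝ} (hp : ∀ ω, 0 ≤ p ω) {n : ℕ} (s : Fin n → Ω) :
    0 ≤ block p n s :=
  Finset.prod_nonneg fun i _ => hp (s i)

theorem pos_of_block_pos {Ω : Type*} {p : Ω → ℝ} (hp : ∀ ω, 0 ≤ p ω) {n : ℕ} {s : Fin n → Ω}
    (hs : 0 < block p n s) (i : Fin n) : 0 < p (s i) :=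
  (hp (s i)).lt_of_ne fun h => hs.ne' (Finset.prod_eq_zero (Finset.mem_univ i) h.symm)

theorem sum_prod_block {Ω : Type*} [Fintype Ω] (n : ℕ) (g : Fin n → Ω → ℝ) :
    ∑ s : Fin n → Ω, ∏ i, g i (s i) = ∏ i, ∑ ω, g i ω := by
  classical
  rw [Finset.prod_univ_sum, Fintype.piFinset_univ]

theorem sum_block {Ω : Type*} [Fintype Ω] {p : Ω → ℝ} (hp : ∑ ω, p ω = 1) (n : ℕ) :
    ∑ s, block p n s = 1 := by
  simp only [block]
  rw [sum_prod_block n fun _ => p]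
  simp [hp]

/-- Putting `g` into the `i`-th factor keeps the product form, and every other factor sums to `1`.
This reduces expectations over blocks to single letters. -/
theorem sum_block_mul {Ω : Type*} [Fintype Ω] {p : Ω → ℝ} (hp : ∑ ω, p ω = 1) {n : ℕ} (i : Fin n)
    (g : Ω → ℝ) : ∑ s, block p n s * g (s i) = ∑ ω, p ω * g ω := by
  have h : ∀ s : Fin n → Ω, block p n s * g (s i) =
      ∏ j, (if j = i then p (s j) * g (s j) else p (s j)) := fun s => by
    rw [block, ← Finset.mul_prod_erase _ _ (Finset.mem_univ i),
      ← Finset.mul_prod_erase _ (fun j => if j = i then _ else _) (Finset.mem_univ i), if_pos rfl,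
      Finset.prod_congr rfl fun j hj => if_neg (Finset.ne_of_mem_erase hj)]
    ring
  simp only [h]
  rw [sum_prod_block n fun j ω => if j = i then p ω * g ω else p ω,
    ← Finset.mul_prod_erase _ _ (Finset.mem_univ i)]
  rw [Finset.prod_congr rfl fun j hj => by
    rw [Finset.sum_congr rfl fun ω _ => if_neg (Finset.ne_of_mem_erase hj), hp]]
  simp

theorem law_block {Ω α : Type*} [Fintype Ω] (p : Ω → ℝ) (n : ℕ) (A : Ω → α) (a : Fin n → α) :
    law (block p n) (fun s i => A (s i)) a = ∏ i, law p A (a i) := by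
  classical
  simp only [law_eq_sum_ite]
  rw [← sum_prod_block n fun i ω => if A ω = a i then p ω else 0]
  refine Finset.sum_congr rfl fun s _ => ?_
  rw [Finset.prod_ite_zero]
  simp [funext_iff, block]

theorem law_block_pair {Ω α β : Type*} [Fintype Ω] (p : Ω → ℝ) (n : ℕ) (A : Ω → α) (B : Ω → β)
    (a : Fin n → α) (b : Fin n → β) :
    law (block p n) (fun s => ((fun i => A (s i)), fun i => B (s i))) (a, b) =
      ∏ i, law p (fun ω => (A ω, B ω)) (a i, b i) := by
  rw [← law_block p n (fun ω => (A ω, B ω)) fun i => (a i, b i)]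
  refine law_congr _ fun s => ?_
  simp only [Prod.mk.injEq, funext_iff, forall_and]

/-! ### Degraded side-information -/

/-- Markov chains in product form, for a function of the past. -/
theorem IsMarkov.law_comp_mul {Ω α β γ δ : Type*} [Fintype Ω] [Fintype α] {p : Ω → ℝ}
    (hp : ∀ ω, 0 ≤ p ω) {A : Ω → α} {B : Ω → β} {C : Ω → γ} (h : IsMarkov p A B C) (f : α → δ)
    (d : δ) (b : β) (c : γ) :
    law p (fun ω => (f (A ω), B ω, C ω)) (d, b, c) * law p B b =
      law p (fun ω => (f (A ω), B ω)) (d, b) * law p (fun ω => (B ω, C ω)) (b, c) := by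
  classical
  rw [law_comp_pair p A (fun ω => (B ω, C ω)) f, law_comp_pair p A B f, Finset.sum_mul,
    Finset.sum_mul]
  refine Finset.sum_congr rfl fun a _ => ?_
  rw [h a b c]
  split_ifs with hb
  · field_simp
  · have h0 : law p (fun ω => (B ω, C ω)) (b, c) = 0 :=
      le_antisymm ((law_mono hp fun _ h => (Prod.mk.inj h).1).trans (not_lt.1 hb))
        (law_nonneg hp _ _)
    rw [h0]
    ring

section Degraded

variable {t : ℕ} {W Y : Fin t → Type*}

/-- The components `W_j`, `j < k`, of the source symbol. -/
def past (k : Fin t) (ω : (∀ l, W l) × (∀ l, Y l)) (j : {j : Fin t // j < k}) : W j := ω.1 j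

/-- The conditional pmf of `W_k` given `W_j`, `j < k`, and `Y_l`. -/
def srcCond [∀ l, Fintype (W l)] [∀ l, Fintype (Y l)] (q : (∀ l, W l) × (∀ l, Y l) → ℝ)
    (k l : Fin t) (a : W k) (b : (∀ j : {j : Fin t // j < k}, W j) × Y l) : ℝ :=
  condProb q (fun ω => ω.1 k) (fun ω => (past k ω, ω.2 l)) a b

variable [∀ l, Fintype (W l)] [∀ l, Fintype (Y l)] {q : (∀ l, W l) × (∀ l, Y l) → ℝ}

/-- For degraded side-information, `Y_1, …, Y_l` say no more about the source than `Y_l`. -/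
theorem IsDegraded.law_eq_mul_srcCond (hq : ∀ ω, 0 ≤ q ω) (hdeg : IsDegraded q) (k l : Fin t)
    (a : W k) (b : (∀ j : {j : Fin t // j < k}, W j) × (∀ j : {j : Fin t // j ≤ l}, Y j)) :
    law q (fun ω => (ω.1 k, past k ω, fun j : {j : Fin t // j ≤ l} => ω.2 j)) (a, b) =
      law q (fun ω => (past k ω, fun j : {j : Fin t // j ≤ l} => ω.2 j)) b *
        srcCond q k l a (b.1, b.2 ⟨l, le_rfl⟩) := by
  obtain ⟨u, y⟩ := b
  have hsplit : ∀ ω : (∀ l, W l) × (∀ l, Y l), (fun j : {j : Fin t // j ≤ l} => ω.2 j) = y ↔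
      ω.2 l = y ⟨l, le_rfl⟩ ∧ (fun j : {j : Fin t // j < l} => ω.2 j) =
        fun j : {j : Fin t // j < l} => y ⟨j, j.2.le⟩ := fun ω => by
    simp only [funext_iff, Subtype.forall]
    constructor
    · exact fun h => ⟨h l le_rfl, fun j hj => h j hj.le⟩
    · rintro ⟨h, h'⟩ j hj
      rcases hj.eq_or_lt with rfl | hj
      · exact h
      · exact h' j hj
  -- The Markov property is used for two functions of the past, with and without `W_k`; the quotient
  -- of the two identities is the claim.
  have e₁ := (hdeg l).law_comp_mul hq (fun x => (x.1 k, fun j : {j : Fin t // j < k} => x.1 j))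
    (a, u) (y ⟨l, le_rfl⟩) (fun j => y ⟨j, j.2.le⟩)
  have e₂ := (hdeg l).law_comp_mul hq (fun x => fun j : {j : Fin t // j < k} => x.1 j)
    u (y ⟨l, le_rfl⟩) (fun j => y ⟨j, j.2.le⟩)
  have r₁ : law q (fun ω => (ω.1 k, past k ω, fun j : {j : Fin t // j ≤ l} => ω.2 j)) (a, u, y) =
      law q (fun ω => ((ω.1 k, past k ω), ω.2 l, fun j : {j : Fin t // j < l} => ω.2 j))
        ((a, u), y ⟨l, le_rfl⟩, fun j => y ⟨j, j.2.le⟩) :=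
    law_congr _ fun ω => by simp only [Prod.mk.injEq, hsplit, and_assoc]
  have r₂ : law q (fun ω => (past k ω, fun j : {j : Fin t // j ≤ l} => ω.2 j)) (u, y) =
      law q (fun ω => (past k ω, ω.2 l, fun j : {j : Fin t // j < l} => ω.2 j))
        (u, y ⟨l, le_rfl⟩, fun j => y ⟨j, j.2.le⟩) :=
    law_congr _ fun ω => by simp only [Prod.mk.injEq, hsplit]
  have r₃ : law q (fun ω => (ω.1 k, past k ω, ω.2 l)) (a, u, y ⟨l, le_rfl⟩) =
      law q (fun ω => ((ω.1 k, past k ω), ω.2 l)) ((a, u), y ⟨l, le_rfl⟩) :=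
    law_congr _ fun ω => by simp only [Prod.mk.injEq, and_assoc]
  change _ = law q (fun ω => ((ω.1 k, past k ω), ω.2 l)) ((a, u), y ⟨l, le_rfl⟩) * _ at e₁
  change _ = law q (fun ω => (past k ω, ω.2 l)) (u, y ⟨l, le_rfl⟩) * _ at e₂
  change law q (fun ω => ((ω.1 k, past k ω), ω.2 l, fun j : {j : Fin t // j < l} => ω.2 j))
    ((a, u), y ⟨l, le_rfl⟩, fun j => y ⟨j, j.2.le⟩) * _ = _ at e₁
  change law q (fun ω => (past k ω, ω.2 l, fun j : {j : Fin t // j < l} => ω.2 j))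
    (u, y ⟨l, le_rfl⟩, fun j => y ⟨j, j.2.le⟩) * _ = _ at e₂
  rw [← r₁] at e₁
  rw [← r₂] at e₂
  rw [srcCond, condProb, r₃]
  -- If the conditioning event is null, `srcCond` is `0` by division by zero, and the left side
  -- vanishes too, being the mass of a smaller event.
  rcases (law_nonneg hq (fun ω => (past k ω, ω.2 l)) (u, y ⟨l, le_rfl⟩)).eq_or_lt with h | h
  · rw [← h, div_zero, mul_zero]
    refine le_antisymm (h ▸ law_mono hq fun ω hω => ?_) (law_nonneg hq _ _)
    simp only [Prod.mk.injEq, hsplit] at hω ⊢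
    exact ⟨hω.2.1, hω.2.2.1⟩
  · have hB : 0 < law q (fun ω => ω.2 l) (y ⟨l, le_rfl⟩) :=
      h.trans_le (law_mono hq fun _ h => (Prod.mk.inj h).2)
    rw [← eq_div_iff hB.ne'] at e₁ e₂
    rw [e₁, e₂]
    field_simp

theorem condEntropy_eq_sum_srcCond (k l : Fin t) :
    condEntropy q (fun ω => ω.1 k) (fun ω => (past k ω, ω.2 l)) =
      -∑ ω, q ω * Real.logb 2 (srcCond q k l (ω.1 k) (past k ω, ω.2 l)) :=
  condEntropy_eq_sum _ _ _

theorem srcCond_pos (hq : ∀ ω, 0 ≤ q ω) (k l : Fin t) {ω : (∀ l, W l) × (∀ l, Y l)}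
    (hω : 0 < q ω) : 0 < srcCond q k l (ω.1 k) (past k ω, ω.2 l) :=
  condProb_pos hq (fun ω => ω.1 k) (fun ω => (past k ω, ω.2 l)) hω

end Degraded

/-! ### Converse -/

section Converse

open Classical in
/-- The symmetric channel on `α` with error parameter `δ`, as a subprobability kernel. -/
def fanoKernel (α : Type*) [Fintype α] (δ : ℝ) (a b : α) : ℝ :=
  if a = b then 1 - δ else δ / Fintype.card α

theorem fanoKernel_pos {α : Type*} [Fintype α] {δ : ℝ} (h0 : 0 < δ) (h1 : δ < 1) (a b : α) :
    0 < fanoKernel α δ a b := by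
  have : Nonempty α := ⟨a⟩
  have : (0 : ℝ) < Fintype.card α := by exact_mod_cast Fintype.card_pos
  rw [fanoKernel]
  split_ifs
  · linarith
  · positivity

/-- The diagonal entry is `1 - δ`, without its share `δ / card`, so the bound follows by adding that
share back. -/
theorem sum_fanoKernel_le_one {α : Type*} [Fintype α] {δ : ℝ} (h0 : 0 < δ) (b : α) :
    ∑ a, fanoKernel α δ a b ≤ 1 := by
  classical
  have : Nonempty α := ⟨b⟩
  have hc : (0 : ℝ) < Fintype.card α := by exact_mod_cast Fintype.card_pos
  calc ∑ a, fanoKernel α δ a b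
      ≤ ∑ a, ((if a = b then 1 - δ else 0) + δ / Fintype.card α) := by
        refine Finset.sum_le_sum fun a _ => ?_
        have : 0 ≤ δ / Fintype.card α := by positivity
        rw [fanoKernel]
        split_ifs <;> linarith
    _ = 1 := by
        rw [Finset.sum_add_distrib, Finset.sum_ite_eq' Finset.univ b fun _ => 1 - δ]
        simp
        field_simp
        ring

variable {t : ℕ} {W Y : Fin t → Type*}

/-- Linearises the log-likelihood in the error indicator, so that its expectation involves only the
distortion. For a wrong symbol the extra term `logb 2 (1 - δ)` is nonpositive. -/
theorem le_logb_fanoKernel [∀ l, Fintype (W l)] {δ : ℝ} (h0 : 0 < δ) (h1 : δ < 1) (l : Fin t)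
    (w : ∀ k, W k) (v : W l) :
    Real.logb 2 (1 - δ) + symbolError l w v * Real.logb 2 (δ / Fintype.card (W l)) ≤
      Real.logb 2 (fanoKernel (W l) δ (w l) v) := by
  have : Real.logb 2 (1 - δ) ≤ 0 :=
    Real.logb_nonpos one_lt_two (by linarith) (by linarith)
  rw [fanoKernel, symbolError]
  split_ifs <;> linarith

variable [∀ l, Fintype (W l)] [∀ l, Fintype (Y l)] {q : (∀ l, W l) × (∀ l, Y l) → ℝ}

/-- The likelihood ratio of component `l` of a block when the conditional law of `W_l` is replaced
by the kernel `K`. -/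
def blockRatio (q : (∀ l, W l) × (∀ l, Y l) → ℝ) {n : ℕ} (l : Fin t)
    (K : (Fin n → W l) → (Fin n → Y l) → ℝ) (s : Fin n → (∀ l, W l) × (∀ l, Y l)) : ℝ :=
  K (fun i => (s i).1 l) (fun i => (s i).2 l) /
    ∏ i, srcCond q l l ((s i).1 l) (past l (s i), (s i).2 l)

/-- Replacing in each component the conditional law of `W_l` given `W_1, …, W_{l-1}, Y_l` by a
subprobability kernel from `Y_l` gives a subprobability. -/
theorem IsDegraded.sum_block_mul_prod_blockRatio_le (hq : ∀ ω, 0 ≤ q ω) (hq1 : ∑ ω, q ω = 1)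
    (hdeg : IsDegraded q) {n : ℕ} (K : ∀ l, (Fin n → W l) → (Fin n → Y l) → ℝ)
    (hK : ∀ l w y, 0 ≤ K l w y) (hK1 : ∀ l y, ∑ w, K l w y ≤ 1) :
    ∑ s, block q n s * ∏ l, blockRatio q l (K l) s ≤ 1 := by
  have main : ∀ j : ℕ, j ≤ t →
      ∑ s, block q n s * ∏ l : Fin t with l.val < j, blockRatio q l (K l) s ≤ 1 := by
    intro j
    induction j with
    | zero => intro _; simp [sum_block hq1]
    | succ j ih =>
      intro hj
      let l : Fin t := ⟨j, hj⟩
      -- Components are removed from the last one down: the factors before `l` depend only on `W_k`,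
      -- `k < l`, and `Y_k`, `k < l`, hence only on `B` below, given which `W_l` can be summed out.
      refine le_trans ?_ (ih (by omega))
      have hins : (Finset.univ.filter fun k : Fin t => k.val < j + 1) =
          insert l (Finset.univ.filter fun k : Fin t => k.val < j) := by
        ext k
        simp only [Finset.mem_filter, Finset.mem_univ, true_and, Finset.mem_insert, Fin.ext_iff, l]
        omega
      have hnot : l ∉ Finset.univ.filter fun k : Fin t => k.val < j := by simp [l]
      have hprod : ∀ s, ∏ k : Fin t with k.val < j, blockRatio q k (K k) s =
          ∏ k : {k : Fin t // k < l}, blockRatio q (k : Fin t) (K k) s := fun s =>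
        Finset.prod_subtype _ (fun k => by simp [l, Fin.lt_def]) _
      simp only [hins, Finset.prod_insert hnot, hprod]
      let B : (∀ l, W l) × (∀ l, Y l) → (∀ k : {k : Fin t // k < l}, W k) ×
        (∀ k : {k : Fin t // k ≤ l}, Y k) := fun ω => (past l ω, fun k => ω.2 k)
      have key := sum_mul_div_le (p := block q n) (block_nonneg hq)
        (fun s i => (s i).1 l) (fun s i => B (s i))
        (fun a b => ∏ i, srcCond q l l (a i) ((b i).1, (b i).2 ⟨l, le_rfl⟩))
        (fun a b => K l a fun i => (b i).2 ⟨l, le_rfl⟩)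
        (fun b => ∏ k : {k : Fin t // k < l}, (K k (fun i => (b i).1 k)
          (fun i => (b i).2 ⟨k, k.2.le⟩) / ∏ i, srcCond q (k : Fin t) k ((b i).1 k)
            ((fun m => (b i).1 ⟨m, m.2.trans k.2⟩), (b i).2 ⟨k, k.2.le⟩)))
        (fun b => Finset.prod_nonneg fun k _ => div_nonneg (hK _ _ _)
          (Finset.prod_nonneg fun i _ => condProb_nonneg hq _ _ _ _))
        (fun a b => by
          rw [law_block_pair q n (fun ω => ω.1 l) B, law_block q n B, ← Finset.prod_mul_distrib]
          exact Finset.prod_congr rfl fun i _ => hdeg.law_eq_mul_srcCond hq l l (a i) (b i))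
        (fun a b => hK _ _ _) (fun b => hK1 _ _)
      refine le_trans (le_of_eq (Finset.sum_congr rfl fun s _ => ?_)) key
      rw [mul_comm (blockRatio q l (K l) s)]
      rfl
  simpa using main t le_rfl

/-- Fano-type lower bound on the sum rate of a code. -/
theorem IsDegraded.le_sum_rate (hq : ∀ ω, 0 ≤ q ω) (hq1 : ∑ ω, q ω = 1) (hdeg : IsDegraded q)
    {n : ℕ} (hn : 0 < n) (c : Code (∀ l, W l) Y W n) {δ : ℝ} (h0 : 0 < δ) (h1 : δ < 1) :
    ∑ l, (condEntropy q (fun ω => ω.1 l) (fun ω => (past l ω, ω.2 l)) + (Real.logb 2 (1 - δ) +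
      c.distortion q symbolError l * Real.logb 2 (δ / Fintype.card (W l)))) ≤ ∑ l, c.rate l := by
  classical
  have hn' : (0 : ℝ) < n := by exact_mod_cast hn
  obtain ⟨ω₀⟩ : Nonempty ((∀ l, W l) × (∀ l, Y l)) := by
    by_contra h
    rw [not_nonempty_iff] at h
    simp at hq1
  let K : (∀ l, Fin (c.m l)) → ∀ l, (Fin n → W l) → (Fin n → Y l) → ℝ := fun m l w y =>
    ∏ i, fanoKernel (W l) δ (w i) (c.dec l (fun k => m k) y i)
  have hKpos : ∀ m l w y, 0 < K m l w y := fun m l w y =>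
    Finset.prod_pos fun i _ => fanoKernel_pos h0 h1 _ _
  have hK1 : ∀ m l y, ∑ w, K m l w y ≤ 1 := fun m l y => by
    simp only [K]
    rw [sum_prod_block n fun i a => fanoKernel (W l) δ a (c.dec l (fun k => m k) y i)]
    exact Finset.prod_le_one
      (fun i _ => Finset.sum_nonneg fun a _ => (fanoKernel_pos h0 h1 _ _).le)
      fun i _ => sum_fanoKernel_le_one h0 _
  let F : (∀ l, Fin (c.m l)) → (Fin n → (∀ l, W l) × (∀ l, Y l)) → ℝ := fun m s =>
    ∏ l, blockRatio q l (K m l) s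
  have hF0 : ∀ m s, 0 ≤ F m s := fun m s => Finset.prod_nonneg fun l _ =>
    div_nonneg (hKpos _ _ _ _).le (Finset.prod_nonneg fun i _ => condProb_nonneg hq _ _ _ _)
  let e : (Fin n → (∀ l, W l) × (∀ l, Y l)) → ∀ l, Fin (c.m l) := fun s => c.enc fun i => (s i).1
  have hm : ∀ l, 0 < c.m l := fun l => (Nat.zero_le _).trans_lt (e (fun _ => ω₀) l).2
  let N : ℝ := ∏ l, (c.m l : ℝ)
  have hN : 0 < N := Finset.prod_pos fun l _ => by exact_mod_cast hm l
  have hEF : ∑ s, block q n s * F (e s) s ≤ N :=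
    -- Enlarging the term at the actual message to the sum over all messages makes `m` independent
    -- of the source, as the change of measure requires.
    calc ∑ s, block q n s * F (e s) s ≤ ∑ s, ∑ m, block q n s * F m s :=
          Finset.sum_le_sum fun s _ => Finset.single_le_sum
            (f := fun m => block q n s * F m s)
            (fun m _ => mul_nonneg (block_nonneg hq s) (hF0 m s)) (Finset.mem_univ _)
      _ = ∑ m, ∑ s, block q n s * F m s := Finset.sum_comm
      _ ≤ ∑ m : ∀ l, Fin (c.m l), 1 := Finset.sum_le_sum fun m _ =>
          hdeg.sum_block_mul_prod_blockRatio_le hq hq1 (K m) (fun l w y => (hKpos m l w y).le)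
            (hK1 m)
      _ = N := by simp [N]
  let G : (Fin n → (∀ l, W l) × (∀ l, Y l)) → ℝ := fun s => ∑ l, ∑ i,
    (Real.logb 2 (1 - δ) + symbolError l (s i).1
      (c.replica l (fun j => (s j).1) (fun j => (s j).2 l) i) *
        Real.logb 2 (δ / Fintype.card (W l)) -
      Real.logb 2 (srcCond q l l ((s i).1 l) (past l (s i), (s i).2 l)))
  have hlog2 : 0 < Real.log 2 := Real.log_pos one_lt_two
  -- Pointwise form of Jensen's inequality: `log x ≤ x - 1` at `x = F / N`. Null blocks are
  -- separated because `srcCond` may vanish there.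
  have hG : ∀ s, block q n s * G s ≤
      block q n s * Real.logb 2 N + (block q n s * F (e s) s / N - block q n s) / Real.log 2 := by
    intro s
    rcases (block_nonneg hq s).eq_or_lt with h | h
    · simp [← h]
    have hc : ∀ i l, 0 < srcCond q l l ((s i).1 l) (past l (s i), (s i).2 l) := fun i l =>
      srcCond_pos hq l l (pos_of_block_pos hq h i)
    have hF : 0 < F (e s) s := Finset.prod_pos fun l _ =>
      div_pos (hKpos _ _ _ _) (Finset.prod_pos fun i _ => hc i l)
    have hGF : G s ≤ Real.logb 2 (F (e s) s) := by
      simp only [F, blockRatio]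
      rw [Real.logb_prod _ _ fun l _ =>
        (div_pos (hKpos _ _ _ _) (Finset.prod_pos fun i _ => hc i l)).ne']
      refine Finset.sum_le_sum fun l _ => ?_
      rw [Real.logb_div (hKpos _ _ _ _).ne' (Finset.prod_pos fun i _ => hc i l).ne',
        Real.logb_prod _ _ fun i _ => (hc i l).ne',
        Real.logb_prod _ _ fun i _ => (fanoKernel_pos h0 h1 _ _).ne', ← Finset.sum_sub_distrib]
      exact Finset.sum_le_sum fun i _ => sub_le_sub_right (le_logb_fanoKernel h0 h1 l _ _) _
    have hlog : Real.logb 2 (F (e s) s) ≤ Real.logb 2 N + (F (e s) s / N - 1) / Real.log 2 := by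
      have h2 := Real.log_le_sub_one_of_pos (div_pos hF hN)
      rw [Real.log_div hF.ne' hN.ne'] at h2
      rw [Real.logb, Real.logb, ← add_div]
      gcongr
      linarith
    calc block q n s * G s
        ≤ block q n s * (Real.logb 2 N + (F (e s) s / N - 1) / Real.log 2) :=
          mul_le_mul_of_nonneg_left (hGF.trans hlog) h.le
      _ = _ := by ring
  have hsum : ∑ s, block q n s * G s ≤ Real.logb 2 N := by
    refine (Finset.sum_le_sum fun s _ => hG s).trans ?_
    rw [Finset.sum_add_distrib, ← Finset.sum_mul, ← Finset.sum_div, Finset.sum_sub_distrib,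
      ← Finset.sum_div, sum_block hq1, one_mul]
    have : (∑ s, block q n s * F (e s) s) / N - 1 ≤ 0 := by
      rw [sub_nonpos, div_le_one hN]
      exact hEF
    have := div_nonpos_of_nonpos_of_nonneg this hlog2.le
    linarith
  have hGeq : ∑ s, block q n s * G s = n * ∑ l, (condEntropy q (fun ω => ω.1 l)
      (fun ω => (past l ω, ω.2 l)) + (Real.logb 2 (1 - δ) +
        c.distortion q symbolError l * Real.logb 2 (δ / Fintype.card (W l)))) := by
    simp only [G, Finset.mul_sum]
    rw [Finset.sum_comm]
    refine Finset.sum_congr rfl fun l _ => ?_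
    have e1 : ∑ s, ∑ i : Fin n, block q n s *
        Real.logb 2 (srcCond q l l ((s i).1 l) (past l (s i), (s i).2 l)) =
        -(n * condEntropy q (fun ω => ω.1 l) (fun ω => (past l ω, ω.2 l))) := by
      rw [Finset.sum_comm, Finset.sum_congr rfl fun i _ => sum_block_mul hq1 i
        fun ω => Real.logb 2 (srcCond q l l (ω.1 l) (past l ω, ω.2 l)),
        condEntropy_eq_sum_srcCond]
      simp
    have e2 : ∑ s, ∑ i : Fin n, block q n s * Real.logb 2 (1 - δ) = n * Real.logb 2 (1 - δ) := by
      rw [Finset.sum_comm, ← Finset.sum_mul, sum_block hq1]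
      simp
    have e3 : ∑ s, ∑ i : Fin n, block q n s * (symbolError l (s i).1
        (c.replica l (fun j => (s j).1) (fun j => (s j).2 l) i) *
          Real.logb 2 (δ / Fintype.card (W l))) =
        n * (c.distortion q symbolError l * Real.logb 2 (δ / Fintype.card (W l))) := by
      rw [Code.distortion, Finset.sum_mul, Finset.mul_sum]
      refine Finset.sum_congr rfl fun s _ => ?_
      simp only [← mul_assoc]
      rw [← Finset.sum_mul, ← Finset.mul_sum, block]
      field_simp
    simp only [mul_sub, mul_add, Finset.sum_sub_distrib, Finset.sum_add_distrib, e1, e2, e3]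
    ring
  have hrate : Real.logb 2 N = n * ∑ l, c.rate l := by
    rw [Real.logb_prod _ _ fun l _ => by exact_mod_cast (hm l).ne', Finset.mul_sum]
    refine Finset.sum_congr rfl fun l _ => ?_
    rw [Code.rate]
    field_simp
  rw [hGeq, hrate] at hsum
  exact le_of_mul_le_mul_left hsum hn'

-- The Fano bound is used with `δ` fixed while `ε → 0`, which kills the distortion times `logb 2 (δ
-- / card)`; only then does `δ → 0`.
open Filter Topology in
theorem IsDegraded.sum_condEntropy_le (hq : ∀ ω, 0 ≤ q ω) (hq1 : ∑ ω, q ω = 1)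
    (hdeg : IsDegraded q) {r : ℝ} (hr : r ∈ singleChannelRates q symbolError 0) :
    ∑ l, condEntropy q (fun ω => ω.1 l) (fun ω => (past l ω, ω.2 l)) ≤ r := by
  obtain ⟨hr0, -, hr⟩ := hr
  set h := ∑ l, condEntropy q (fun ω => ω.1 l) (fun ω => (past l ω, ω.2 l)) with hh
  have step : ∀ δ : ℝ, 0 < δ → δ < 1 → h + t * Real.logb 2 (1 - δ) ≤ r := by
    intro δ h0 h1
    set Λ := ∑ l, Real.logb 2 (δ / Fintype.card (W l)) with hΛ
    have hε : ∀ ε > 0, h + t * Real.logb 2 (1 - δ) ≤ r + t * ε - ε * Λ := by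
      intro ε hε
      obtain ⟨n, hn, c, hd, hrate⟩ := hr ε hε
      have h3 := hdeg.le_sum_rate hq hq1 hn c h0 h1
      have h4 : ε * Λ ≤ ∑ l, c.distortion q symbolError l *
          Real.logb 2 (δ / Fintype.card (W l)) := by
        rw [hΛ, Finset.mul_sum]
        refine Finset.sum_le_sum fun l _ => ?_
        have hdl := hd l
        simp only [Pi.zero_apply, zero_add] at hdl
        refine mul_le_mul_of_nonpos_right hdl ?_
        refine Real.logb_nonpos one_lt_two (by positivity) ?_
        rcases Nat.eq_zero_or_pos (Fintype.card (W l)) with h | h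
        · simp [h]
        · have : (1 : ℝ) ≤ Fintype.card (W l) := by exact_mod_cast h
          exact (div_le_self h0.le this).trans h1.le
      have h5 : ∑ l, c.rate l ≤ r + t * ε := by
        refine (Finset.sum_le_sum fun l _ => hrate l).trans ?_
        rw [Finset.sum_add_distrib]
        have : ∑ l : Fin t, (if (l : ℕ) = 0 then r else 0) ≤ r := by
          -- Without channels the sum is empty and `0 ≤ r` is what remains.
          cases t with
          | zero => simpa using hr0
          | succ t => simp
        simpa using this
      rw [Finset.sum_add_distrib, Finset.sum_add_distrib] at h3
      simp only [Finset.sum_const, Finset.card_univ, Fintype.card_fin, nsmul_eq_mul] at h3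
      linarith
    have hlim : Tendsto (fun ε : ℝ => r + t * ε - ε * Λ) (𝓝[>] 0) (𝓝 r) := by
      have : Continuous fun ε : ℝ => r + t * ε - ε * Λ := by fun_prop
      simpa using (this.tendsto 0).mono_left nhdsWithin_le_nhds
    exact ge_of_tendsto hlim (eventually_mem_nhdsWithin.mono fun ε hε' => hε ε hε')
  have hlim : Tendsto (fun δ : ℝ => h + t * Real.logb 2 (1 - δ)) (𝓝[>] 0) (𝓝 h) := by
    have : ContinuousAt (fun δ : ℝ => h + t * Real.logb 2 (1 - δ)) 0 := by
      have h1 : ContinuousAt (fun δ : ℝ => Real.log (1 - δ)) 0 :=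
        ContinuousAt.log (by fun_prop) (by norm_num)
      simp only [Real.logb]
      exact continuousAt_const.add (continuousAt_const.mul (h1.div_const _))
    simpa using this.tendsto.mono_left nhdsWithin_le_nhds
  refine le_of_tendsto hlim ?_
  filter_upwards [Ioo_mem_nhdsGT one_pos] with δ hδ using step δ hδ.1 hδ.2

end Converse

/-! ### Achievability -/

section Achievability

/-! ### Random binning. -/

/-- Two distinct points collide under at most a fraction `1 / M` of all maps to `Fin M`. -/
theorem card_collision_mul_le {α : Type*} [Fintype α] [DecidableEq α] {M : ℕ} {a b : α}
    (hab : a ≠ b) : (Finset.univ.filter fun f : α → Fin M => f a = f b).card * M ≤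
      Fintype.card (α → Fin M) := by
  have h : Fintype.card ({f : α → Fin M // f a = f b} × Fin M) ≤ Fintype.card (α → Fin M) := by
    -- Overwriting `f a` loses nothing, since `f a = f b` can be read off at `b`.
    refine Fintype.card_le_of_injective (fun x => Function.update x.1.1 a x.2) ?_
    rintro ⟨⟨f, hf⟩, v⟩ ⟨⟨g, hg⟩, w⟩ h
    have hne : ∀ x, x ≠ a → f x = g x := fun x hx => by
      simpa [hx] using congrFun h x
    have hv : v = w := by simpa using congrFun h a
    have hfg : f = g := by
      funext x
      by_cases hx : x = a
      · rw [hx, hf, hg, hne b hab.symm]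
      · exact hne x hx
    simp [hfg, hv]
  rwa [Fintype.card_prod, Fintype.card_subtype, Fintype.card_fin] at h

/-- Under `f`, the point `a` shares its bin with another point of the set `T`. -/
def Collides {α β : Type*} (f : α → β) (T : α → Prop) (a : α) : Prop :=
  ∃ b, b ≠ a ∧ f b = f a ∧ T b

open Classical in
/-- Random binning: some map to `M` bins has few collisions with small candidate sets, on
average over the source and simultaneously for a finite family of candidate sets. -/
theorem exists_binning {S α ι : Type*} [Fintype S] [Fintype α] [Fintype ι] {M : ℕ} (hM : 0 < M)
    {p : S → ℝ} (hp : ∀ s, 0 ≤ p s) (hp1 : ∑ s, p s = 1) (A : S → α) (T : ι → S → α → Prop)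
    {K : ℝ} (hT : ∀ l s, ((Finset.univ.filter (T l s)).card : ℝ) ≤ K) :
    ∃ f : α → Fin M, ∑ l, ∑ s, p s *
      (if Collides f (T l s) (A s) then 1 else 0) ≤ Fintype.card ι * (K / M) := by
  have hM' : (0 : ℝ) < M := by exact_mod_cast hM
  have : Nonempty (Fin M) := ⟨⟨0, hM⟩⟩
  have hcoll : ∀ l s, ∑ f : α → Fin M,
      (if Collides f (T l s) (A s) then (1 : ℝ) else 0) ≤
        Fintype.card (α → Fin M) * (K / M) := by
    intro l s
    calc ∑ f : α → Fin M, (if Collides f (T l s) (A s) then (1 : ℝ) else 0)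
        -- Union bound over the candidates.
        ≤ ∑ f : α → Fin M, ∑ a with T l s a, (if a ≠ A s ∧ f a = f (A s) then (1 : ℝ) else 0) := by
          refine Finset.sum_le_sum fun f _ => ?_
          split_ifs with h
          · obtain ⟨a, h1, h2, h3⟩ := h
            refine le_trans (by simp [h1, h2]) (Finset.single_le_sum
              (f := fun a => if a ≠ A s ∧ f a = f (A s) then (1 : ℝ) else 0)
              (fun a _ => by split_ifs <;> norm_num)
              (Finset.mem_filter.2 ⟨Finset.mem_univ a, h3⟩))
          · exact Finset.sum_nonneg fun a _ => by split_ifs <;> norm_num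
      _ = ∑ a with T l s a, ∑ f : α → Fin M, (if a ≠ A s ∧ f a = f (A s) then (1 : ℝ) else 0) :=
          Finset.sum_comm
      _ ≤ ∑ a with T l s a, (Fintype.card (α → Fin M) : ℝ) / M := by
          refine Finset.sum_le_sum fun a _ => ?_
          by_cases ha : a = A s
          · simp [ha]
            positivity
          · rw [le_div_iff₀ hM']
            simp only [ne_eq, ha, not_false_eq_true, true_and, Finset.sum_boole]
            exact_mod_cast card_collision_mul_le ha
      _ ≤ Fintype.card (α → Fin M) * (K / M) := by
          rw [Finset.sum_const, nsmul_eq_mul]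
          calc _ ≤ K * ((Fintype.card (α → Fin M) : ℝ) / M) :=
                mul_le_mul_of_nonneg_right (hT l s) (by positivity)
            _ = _ := by ring
  have hsum : ∑ f : α → Fin M, ∑ l, ∑ s, p s *
      (if Collides f (T l s) (A s) then (1 : ℝ) else 0) ≤
        ∑ f : α → Fin M, Fintype.card ι * (K / M) := by
    rw [Finset.sum_comm]
    calc _ ≤ ∑ l : ι, (Fintype.card (α → Fin M) * (K / M) : ℝ) := by
          refine Finset.sum_le_sum fun l _ => ?_
          rw [Finset.sum_comm]
          calc _ ≤ ∑ s, p s * (Fintype.card (α → Fin M) * (K / M) : ℝ) :=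
                Finset.sum_le_sum fun s _ => by
                  rw [← Finset.mul_sum]
                  exact mul_le_mul_of_nonneg_left (hcoll l s) (hp s)
            _ = _ := by rw [← Finset.sum_mul, hp1, one_mul]
      _ = _ := by
          simp only [Finset.sum_const, Finset.card_univ, nsmul_eq_mul]
          ring
  -- Some map does no worse than the average. The sum over `l` is inside the average, so one map
  -- serves the whole family.
  obtain ⟨f, -, hf⟩ := Finset.exists_le_of_sum_le Finset.univ_nonempty hsum
  exact ⟨f, hf⟩

/-! ### Tail bound, counting, and codes on one channel. -/

open Filter Topology in
open Classical in
/-- Chernoff bound for the product of `n` independent copies of `c`. -/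
theorem exists_tail_bound {Ω : Type*} [Fintype Ω] {p : Ω → ℝ} (hp : ∀ ω, 0 ≤ p ω)
    (hp1 : ∑ ω, p ω = 1) {c : Ω → ℝ} (hc : ∀ ω, 0 < p ω → 0 < c ω) {θ : ℝ}
    (hθ : -∑ ω, p ω * Real.logb 2 (c ω) < θ) :
    ∃ ρ : ℝ, 0 ≤ ρ ∧ ρ < 1 ∧ ∀ n : ℕ, ∑ s, block p n s *
      (if ∏ i, c (s i) < (2 : ℝ) ^ (-(n * θ)) then 1 else 0) ≤ ρ ^ n := by
  have hlog2 : 0 < Real.log 2 := Real.log_pos one_lt_two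
  let x : Ω → ℝ := fun ω => -(θ * Real.log 2 + Real.log (c ω))
  let φ : ℝ → ℝ := fun u => ∑ ω, p ω * Real.exp (u * x ω)
  have hφ0 : φ 0 = 1 := by simp [φ, hp1]
  have hφ' : HasDerivAt φ (∑ ω, p ω * x ω) 0 := by
    refine HasDerivAt.fun_sum fun ω _ => ?_
    have h1 : HasDerivAt (fun u : ℝ => Real.exp (u * x ω)) (Real.exp (0 * x ω) * (1 * x ω)) 0 :=
      ((hasDerivAt_id (0 : ℝ)).mul_const (x ω)).exp
    simpa using h1.const_mul (p ω)
  have hneg : ∑ ω, p ω * x ω < 0 := by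
    have h1 : ∑ ω, p ω * x ω = (-∑ ω, p ω * Real.logb 2 (c ω) - θ) * Real.log 2 := by
      have h2 : ∀ ω, p ω * x ω =
          -(p ω * Real.logb 2 (c ω)) * Real.log 2 - p ω * (θ * Real.log 2) := fun ω => by
        simp only [x, Real.logb]
        field_simp
        ring
      simp only [h2]
      rw [Finset.sum_sub_distrib, ← Finset.sum_mul, ← Finset.sum_mul, hp1, Finset.sum_neg_distrib]
      ring
    rw [h1]
    exact mul_neg_of_neg_of_pos (by linarith) hlog2
  -- The moment generating function `φ` of `x` is `1` at `0` with negative derivative, so it drops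
  -- below `1` just to the right of `0`.
  obtain ⟨u, hu, hφu⟩ : ∃ u > 0, φ u < 1 := by
    have h1 := (hasDerivAt_iff_tendsto_slope.1 hφ').mono_left
      (nhdsWithin_mono 0 fun u (hu : 0 < u) => hu.ne')
    obtain ⟨u, hu, hlt⟩ := ((eventually_mem_nhdsWithin (a := (0 : ℝ)) (s := Set.Ioi 0)).and
      (h1.eventually_lt_const hneg)).exists
    refine ⟨u, hu, ?_⟩
    have hu : (0 : ℝ) < u := hu
    rw [slope_def_field, sub_zero, hφ0, div_neg_iff] at hlt
    rcases hlt with h | h <;> linarith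
  refine ⟨φ u, Finset.sum_nonneg fun ω _ => mul_nonneg (hp ω) (Real.exp_nonneg _), hφu,
    fun n => ?_⟩
  have hpow : φ u ^ n = ∑ s : Fin n → Ω, ∏ i, (p (s i) * Real.exp (u * x (s i))) := by
    rw [sum_prod_block n fun _ ω => p ω * Real.exp (u * x ω)]
    simp [φ]
  rw [hpow]
  refine Finset.sum_le_sum fun s _ => ?_
  rw [Finset.prod_mul_distrib]
  change _ ≤ block p n s * _
  rcases (block_nonneg hp s).eq_or_lt with h | h
  · simp [← h]
  refine mul_le_mul_of_nonneg_left ?_ h.le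
  split_ifs with hs
  · rw [← Real.exp_sum, ← Finset.mul_sum]
    refine Real.one_le_exp (mul_nonneg hu.le ?_)
    have hci : ∀ i, 0 < c (s i) := fun i => hc _ (pos_of_block_pos hp h i)
    have h3 := Real.log_lt_log (Finset.prod_pos fun i _ => hci i) hs
    rw [Real.log_prod fun i _ => (hci i).ne', Real.log_rpow two_pos] at h3
    simp only [x, Finset.sum_neg_distrib, Finset.sum_add_distrib, Finset.sum_const,
      Finset.card_univ, Fintype.card_fin, nsmul_eq_mul]
    linarith
  · exact Finset.prod_nonneg fun i _ => Real.exp_nonneg _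

/-- A nonnegative function with sum at most `1` exceeds `1 / K` at most `K` times. -/
theorem card_filter_inv_le {α : Type*} [Fintype α] {g : α → ℝ} (hg : ∀ a, 0 ≤ g a)
    (hg1 : ∑ a, g a ≤ 1) {K : ℝ} (hK : 0 < K) [DecidablePred fun a => K⁻¹ ≤ g a] :
    ((Finset.univ.filter fun a => K⁻¹ ≤ g a).card : ℝ) ≤ K := by
  have h : ((Finset.univ.filter fun a => K⁻¹ ≤ g a).card : ℝ) * K⁻¹ ≤ 1 :=
    calc _ = ∑ a with K⁻¹ ≤ g a, K⁻¹ := by simp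
      _ ≤ ∑ a with K⁻¹ ≤ g a, g a :=
        Finset.sum_le_sum fun a ha => (Finset.mem_filter.1 ha).2
      _ ≤ ∑ a, g a := Finset.sum_le_univ_sum_of_nonneg hg
      _ ≤ 1 := hg1
  rwa [← div_eq_mul_inv, div_le_one hK] at h

/-- A code that only uses the first channel. -/
theorem exists_code_single_channel {t : ℕ} {X : Type*} {Y Xhat : Fin t → Type*} {n M : ℕ}
    (enc : (Fin n → X) → Fin M) (dec : ∀ l, Fin M → (Fin n → Y l) → Fin n → Xhat l) :
    ∃ c : Code X Y Xhat n, (∀ l, c.m l = if (l : ℕ) = 0 then M else 1) ∧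
      ∀ l x y, c.replica l x y = dec l (enc x) y := by
  -- The other channels carry a one-element message set, hence rate `0`; every decoder sees channel
  -- `0`.
  refine ⟨⟨fun l => if (l : ℕ) = 0 then M else 1,
    fun x l => ⟨if (l : ℕ) = 0 then enc x else 0, by split_ifs <;> simp⟩,
    fun l msg => dec l ⟨msg ⟨⟨0, l.pos⟩, Nat.zero_le _⟩, by
      simpa using (msg ⟨⟨0, l.pos⟩, Nat.zero_le _⟩).2⟩⟩, fun l => rfl, fun l x y => ?_⟩
  simp [Code.replica]

variable {t : ℕ} {W Y : Fin t → Type*} [∀ l, Fintype (W l)] [∀ l, Fintype (Y l)]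
  {q : (∀ l, W l) × (∀ l, Y l) → ℝ}

/-- Better side-information reduces the conditional entropy. -/
theorem IsDegraded.condEntropy_anti (hq : ∀ ω, 0 ≤ q ω) (hq1 : ∑ ω, q ω = 1)
    (hdeg : IsDegraded q) {k l : Fin t} (hkl : k ≤ l) :
    condEntropy q (fun ω => ω.1 k) (fun ω => (past k ω, ω.2 l)) ≤
      condEntropy q (fun ω => ω.1 k) (fun ω => (past k ω, ω.2 k)) := by
  have hlog2 : 0 < Real.log 2 := Real.log_pos one_lt_two
  rw [condEntropy_eq_sum_srcCond, condEntropy_eq_sum_srcCond, neg_le_neg_iff, ← sub_nonpos,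
    ← Finset.sum_sub_distrib]
  -- Conditioning on all `Y_j`, `j ≤ l`, makes both conditional laws kernels of the same variable,
  -- and the true one is `srcCond q k l`. What remains is nonnegativity of relative entropy.
  have key := sum_mul_div_le hq (fun ω => ω.1 k)
    (fun ω => (past k ω, fun j : {j : Fin t // j ≤ l} => ω.2 j))
    (fun a b => srcCond q k l a (b.1, b.2 ⟨l, le_rfl⟩))
    (fun a b => srcCond q k k a (b.1, b.2 ⟨k, hkl⟩)) (fun _ => 1) (fun _ => zero_le_one)
    (fun a b => hdeg.law_eq_mul_srcCond hq k l a b) (fun a b => condProb_nonneg hq _ _ _ _)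
    (fun b => sum_condProb_le_one _ _ _ _)
  simp only [one_mul, mul_one, hq1] at key
  calc _ ≤ ∑ ω, (q ω * (srcCond q k k (ω.1 k) (past k ω, ω.2 k) /
        srcCond q k l (ω.1 k) (past k ω, ω.2 l)) - q ω) / Real.log 2 := by
        refine Finset.sum_le_sum fun ω _ => ?_
        rcases (hq ω).eq_or_lt with h | h
        · simp [← h]
        have h1 := srcCond_pos hq k k h
        have h2 := srcCond_pos hq k l h
        have h3 := Real.log_le_sub_one_of_pos (div_pos h1 h2)
        rw [Real.log_div h1.ne' h2.ne'] at h3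
        rw [← mul_sub, Real.logb, Real.logb, ← sub_div, ← mul_div_assoc]
        gcongr
        calc _ ≤ _ := mul_le_mul_of_nonneg_left h3 h.le
          _ = _ := by ring
    _ ≤ 0 := by
        rw [← Finset.sum_div, Finset.sum_sub_distrib, hq1]
        exact div_nonpos_of_nonpos_of_nonneg (sub_nonpos.2 key) hlog2.le

/-! ### The binning code and its error analysis. -/

/-- The threshold test for a candidate block `a` for `W_k`, given blocks for `W_j`, `j < k`, and
the side-information `Y_l`. -/
def IsLikely (q : (∀ l, W l) × (∀ l, Y l) → ℝ) {n : ℕ} (θ : ℝ) (k l : Fin t)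
    (u : Fin n → ∀ j : {j : Fin t // j < k}, W j) (y : Fin n → Y l) (a : Fin n → W k) : Prop :=
  ((2 : ℝ) ^ (n * θ))⁻¹ ≤ ∏ i, srcCond q k l (a i) (u i, y i)

-- The product of the conditional laws is a subprobability in the candidate block, so few blocks can
-- exceed the threshold.
open Classical in
theorem card_isLikely_le (hq : ∀ ω, 0 ≤ q ω) {n : ℕ} (θ : ℝ) (k l : Fin t)
    (u : Fin n → ∀ j : {j : Fin t // j < k}, W j) (y : Fin n → Y l) :
    ((Finset.univ.filter (IsLikely q θ k l u y)).card : ℝ) ≤ (2 : ℝ) ^ (n * θ) := by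
  refine card_filter_inv_le (g := fun a : Fin n → W k => ∏ i, srcCond q k l (a i) (u i, y i))
    (fun a => Finset.prod_nonneg fun i _ => condProb_nonneg hq _ _ _ _) ?_ (by positivity)
  rw [sum_prod_block n fun i a => srcCond q k l a (u i, y i)]
  exact Finset.prod_le_one
    (fun i _ => Finset.sum_nonneg fun a _ => condProb_nonneg hq _ _ _ _)
    fun i _ => sum_condProb_le_one _ _ _ _

/-- The candidate source blocks of decoder `l`, given the bins `b` and the side-information `y`. -/
def IsCandidate (q : (∀ l, W l) × (∀ l, Y l) → ℝ) {n : ℕ} (θ : Fin t → ℝ) {M : Fin t → ℕ}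
    (f : ∀ k, (Fin n → W k) → Fin (M k)) (l : Fin t) (b : ∀ k, Fin (M k)) (y : Fin n → Y l)
    (x : Fin n → ∀ k, W k) : Prop :=
  ∀ k ≤ l, f k (fun i => x i k) = b k ∧
    IsLikely q (θ k) k l (fun i j => x i j) y (fun i => x i k)

/-- The error event in decoding `W_k` at decoder `l` when `W_j`, `j < k`, are known: the true block
fails the threshold test, or another block in its bin passes it. -/
def IsAmbiguous (q : (∀ l, W l) × (∀ l, Y l) → ℝ) {n M : ℕ} (θ : ℝ) (k l : Fin t)
    (f : (Fin n → W k) → Fin M) (x : Fin n → ∀ k, W k) (y : Fin n → Y l) : Prop :=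
  ¬ IsLikely q θ k l (fun i j => x i j) y (fun i => x i k) ∨
    Collides f (IsLikely q θ k l (fun i j => x i j) y) (fun i => x i k)

/-- Without ambiguity, all candidates agree with the true block. -/
theorem IsCandidate.eq_of_not_isAmbiguous {n : ℕ} {θ : Fin t → ℝ} {M : Fin t → ℕ}
    {f : ∀ k, (Fin n → W k) → Fin (M k)} {l : Fin t} {x x' : Fin n → ∀ k, W k} {y : Fin n → Y l}
    (hx : ∀ k ≤ l, ¬ IsAmbiguous q (θ k) k l (f k) x y)
    (hx' : IsCandidate q θ f l (fun k => f k fun i => x i k) y x') (k : Fin t) (hk : k ≤ l) :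
    (fun i => x' i k) = fun i => x i k := by
  induction k using WellFoundedLT.induction with
  | ind k ih =>
    by_contra hne
    -- By induction `x'` has the true past, so its threshold test is the one in the collision event;
    -- a wrong `W_k` block would be a collision.
    refine hx k hk (Or.inr ⟨_, hne, (hx' k hk).1, ?_⟩)
    have hpast : (fun (i : Fin n) (j : {j : Fin t // j < k}) => x' i j) =
        fun (i : Fin n) (j : {j : Fin t // j < k}) => x i j := by
      funext i j
      exact congrFun (ih j j.2 (j.2.le.trans hk)) i
    rw [← hpast]
    exact (hx' k hk).2

theorem isCandidate_of_not_isAmbiguous {n : ℕ} {θ : Fin t → ℝ} {M : Fin t → ℕ}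
    {f : ∀ k, (Fin n → W k) → Fin (M k)} {l : Fin t} {x : Fin n → ∀ k, W k} {y : Fin n → Y l}
    (hx : ∀ k ≤ l, ¬ IsAmbiguous q (θ k) k l (f k) x y) :
    IsCandidate q θ f l (fun k => f k fun i => x i k) y x := fun k hk =>
  ⟨rfl, by_contra fun h => hx k hk (Or.inl h)⟩

open Classical in
/-- The binning code and its error probability. -/
theorem exists_binning_code (hq : ∀ ω, 0 ≤ q ω) [Nonempty (∀ k, W k)] {n : ℕ} (hn : 0 < n)
    (θ : Fin t → ℝ) {M : Fin t → ℕ} (f : ∀ k, (Fin n → W k) → Fin (M k)) :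
    ∃ c : Code (∀ l, W l) Y W n, (∀ l, c.m l = if (l : ℕ) = 0 then ∏ k, M k else 1) ∧
      ∀ l, c.distortion q symbolError l ≤ ∑ k with k ≤ l, ∑ s, block q n s *
        (if IsAmbiguous q (θ k) k l (f k) (fun i => (s i).1) (fun i => (s i).2 l)
          then 1 else 0) := by
  have hn' : (0 : ℝ) < n := by exact_mod_cast hn
  -- The tuple of bin indices is packed into one message; the decoder picks any candidate, and an
  -- arbitrary block if there is none.
  obtain ⟨c, hm, hrep⟩ := exists_code_single_channel (Y := Y) (Xhat := W)
    (fun x : Fin n → ∀ k, W k => finPiFinEquiv fun k => f k fun i => x i k)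
    (fun l b y i => Classical.epsilon (IsCandidate q θ f l (finPiFinEquiv.symm b) y) i l)
  refine ⟨c, hm, fun l => ?_⟩
  rw [Finset.sum_comm]
  refine Finset.sum_le_sum fun s _ => ?_
  rw [← Finset.mul_sum]
  refine mul_le_mul_of_nonneg_left ?_ (block_nonneg hq s)
  rw [hrep, Equiv.symm_apply_apply]
  by_cases h : ∀ k ≤ l, ¬ IsAmbiguous q (θ k) k l (f k) (fun i => (s i).1) (fun i => (s i).2 l)
  · have hspec := Classical.epsilon_spec ⟨_, isCandidate_of_not_isAmbiguous h⟩
    have heq := hspec.eq_of_not_isAmbiguous h l le_rfl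
    refine le_trans (le_of_eq ?_) (Finset.sum_nonneg fun k _ => by split_ifs <;> norm_num)
    rw [Finset.sum_eq_zero, mul_zero]
    intro i _
    rw [symbolError, if_pos (congrFun heq i).symm]
  · push Not at h
    obtain ⟨k, hk, hamb⟩ := h
    calc _ ≤ 1 / (n : ℝ) * ∑ i : Fin n, 1 := by
          gcongr with i
          rw [symbolError]
          split_ifs <;> norm_num
      _ = 1 := by simp [hn'.ne']
      _ ≤ _ := by
          refine le_trans (le_of_eq ?_) (Finset.single_le_sum (f := fun k => if IsAmbiguous q (θ k)
            k l (f k) (fun i => (s i).1) (fun i => (s i).2 l) then (1 : ℝ) else 0)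
            (fun k _ => by split_ifs <;> norm_num)
            (Finset.mem_filter.2 ⟨Finset.mem_univ k, hk⟩))
          simp [hamb]

open Classical in
theorem sum_isAmbiguous_le (hq : ∀ ω, 0 ≤ q ω) {n M : ℕ} (θ : ℝ) (k l : Fin t)
    (f : (Fin n → W k) → Fin M) :
    ∑ s, block q n s * (if IsAmbiguous q θ k l f (fun i => (s i).1) (fun i => (s i).2 l)
        then (1 : ℝ) else 0) ≤
      ∑ s, block q n s * (if ∏ i, srcCond q k l ((s i).1 k) (past k (s i), (s i).2 l) <
        (2 : ℝ) ^ (-(n * θ)) then 1 else 0) +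
      ∑ s, block q n s * (if Collides f (IsLikely q θ k l (fun i j => (s i).1 j)
        fun i => (s i).2 l) (fun i => (s i).1 k) then 1 else 0) := by
  rw [← Finset.sum_add_distrib]
  refine Finset.sum_le_sum fun s _ => ?_
  rw [← mul_add]
  refine mul_le_mul_of_nonneg_left ?_ (block_nonneg hq s)
  by_cases hA : IsAmbiguous q θ k l f (fun i => (s i).1) (fun i => (s i).2 l)
  · rw [if_pos hA]
    rcases hA with hA | hA
    · rw [IsLikely, not_le, ← Real.rpow_neg two_pos.le] at hA
      have h1 : ∏ i, srcCond q k l ((s i).1 k) (past k (s i), (s i).2 l) <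
        (2 : ℝ) ^ (-(n * θ)) := hA
      rw [if_pos h1]
      split_ifs <;> norm_num
    · rw [if_pos hA]
      split_ifs <;> norm_num
  · rw [if_neg hA]
    split_ifs <;> norm_num

theorem logb_natCeil_rpow_le {x : ℝ} (hx : 0 ≤ x) : Real.logb 2 ⌈(2 : ℝ) ^ x⌉₊ ≤ x + 1 := by
  have h1 : (1 : ℝ) ≤ 2 ^ x := Real.one_le_rpow one_le_two hx
  have h2 := (Nat.ceil_lt_add_one (zero_le_one.trans h1)).le
  have h3 : (0 : ℝ) < ⌈(2 : ℝ) ^ x⌉₊ := (zero_lt_one.trans_le h1).trans_le (Nat.le_ceil _)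
  rw [Real.logb_le_iff_le_rpow one_lt_two h3, Real.rpow_add_one two_ne_zero]
  linarith

open Classical in
/-- A binning of `W_k` at rate `θ + η` that has few collisions at every decoder. -/
theorem exists_binning_isLikely (hq : ∀ ω, 0 ≤ q ω) (hq1 : ∑ ω, q ω = 1) (n : ℕ) (θ η : ℝ)
    (k : Fin t) : ∃ f : (Fin n → W k) → Fin ⌈(2 : ℝ) ^ (n * (θ + η))⌉₊, ∀ l,
      ∑ s, block q n s * (if Collides f (IsLikely q θ k l (fun i j => (s i).1 j)
        fun i => (s i).2 l) (fun i => (s i).1 k) then 1 else 0) ≤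
          t * ((2 : ℝ) ^ (-η)) ^ n := by
  have hM : 0 < ⌈(2 : ℝ) ^ (n * (θ + η))⌉₊ := Nat.ceil_pos.2 (by positivity)
  obtain ⟨f, hf⟩ := exists_binning hM (block_nonneg hq) (sum_block hq1 n)
    (fun s i => (s i).1 k)
    (fun l s => IsLikely q θ k l (fun i j => (s i).1 j) fun i => (s i).2 l)
    (fun l s => card_isLikely_le hq θ k l _ _)
  refine ⟨f, fun l => le_trans ?_ (hf.trans ?_)⟩
  -- The total over all `t` decoders dominates each one, which is the origin of the factor `t`.
  · exact Finset.single_le_sum (f := fun l => ∑ s, block q n s * (if Collides f (IsLikely q θ k l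
      (fun i j => (s i).1 j) fun i => (s i).2 l) (fun i => (s i).1 k) then (1 : ℝ) else 0))
      (fun l _ => Finset.sum_nonneg fun s _ => mul_nonneg (block_nonneg hq s)
        (by split_ifs <;> norm_num)) (Finset.mem_univ l)
  · rw [Fintype.card_fin]
    refine mul_le_mul_of_nonneg_left ?_ (Nat.cast_nonneg t)
    rw [div_le_iff₀ (by exact_mod_cast hM), ← Real.rpow_mul_natCast two_pos.le]
    calc (2 : ℝ) ^ (n * θ) = 2 ^ (-η * n) * 2 ^ (n * (θ + η)) := by
          rw [← Real.rpow_add two_pos]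
          ring_nf
      _ ≤ _ := mul_le_mul_of_nonneg_left (Nat.le_ceil _) (by positivity)

open Classical in
/-- The true block for `W_k` passes the threshold test at decoder `l ≥ k` with high probability. -/
theorem IsDegraded.exists_tail_bound_srcCond (hq : ∀ ω, 0 ≤ q ω) (hq1 : ∑ ω, q ω = 1)
    (hdeg : IsDegraded q) {k : Fin t} {θ : ℝ}
    (hθ : condEntropy q (fun ω => ω.1 k) (fun ω => (past k ω, ω.2 k)) < θ) (l : Fin t) :
    ∃ ρ : ℝ, 0 ≤ ρ ∧ ρ < 1 ∧ (k ≤ l → ∀ n : ℕ,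
      ∑ s, block q n s * (if ∏ i, srcCond q k l ((s i).1 k) (past k (s i), (s i).2 l) <
        (2 : ℝ) ^ (-(n * θ)) then 1 else 0) ≤ ρ ^ n) := by
  by_cases hkl : k ≤ l
  · obtain ⟨ρ, h1, h2, h3⟩ := exists_tail_bound hq hq1
      (c := fun ω => srcCond q k l (ω.1 k) (past k ω, ω.2 l)) (θ := θ)
      (fun ω hω => srcCond_pos hq k l hω) (by
        rw [← condEntropy_eq_sum_srcCond]
        exact (hdeg.condEntropy_anti hq hq1 hkl).trans_lt hθ)
    exact ⟨ρ, h1, h2, fun _ => h3⟩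
  -- For `l < k` nothing is claimed; `0` only makes `ρ` a total function of the decoder.
  · exact ⟨0, le_rfl, one_pos, fun h => absurd h hkl⟩

/-- Rounding up the number of bins costs at most one bit per component, hence `t / n` per symbol. -/
theorem sum_rate_le {n : ℕ} (hn : 0 < n) {h : Fin t → ℝ} (h0 : ∀ k, 0 ≤ h k) {η : ℝ}
    (hη : 0 < η) :
    1 / (n : ℝ) * Real.logb 2 ((∏ k, ⌈(2 : ℝ) ^ (n * (h k + η + η))⌉₊ : ℕ) : ℝ) ≤
      ∑ k, h k + t * (2 * η) + t / n := by
  have hn' : (0 : ℝ) < n := by exact_mod_cast hn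
  have hlogM : Real.logb 2 ((∏ k, ⌈(2 : ℝ) ^ (n * (h k + η + η))⌉₊ : ℕ) : ℝ) ≤
      ∑ k, (n * (h k + η + η) + 1) := by
    rw [Nat.cast_prod, Real.logb_prod _ _ fun k _ => by
      exact_mod_cast (Nat.ceil_pos.2 (by positivity)).ne']
    exact Finset.sum_le_sum fun k _ => logb_natCeil_rpow_le (mul_nonneg hn'.le
      (add_nonneg (add_nonneg (h0 k) hη.le) hη.le))
  calc _ ≤ 1 / (n : ℝ) * ∑ k, (n * (h k + η + η) + 1) :=
        mul_le_mul_of_nonneg_left hlogM (by positivity)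
    _ = ∑ k, h k + t * (2 * η) + t / n := by
        rw [Finset.sum_add_distrib, ← Finset.mul_sum, Finset.sum_add_distrib,
          Finset.sum_add_distrib]
        simp only [Finset.sum_const, Finset.card_univ, Fintype.card_fin, nsmul_eq_mul, mul_one]
        field_simp
        ring

open Filter Topology in
theorem IsDegraded.sum_condEntropy_mem (hq : ∀ ω, 0 ≤ q ω) (hq1 : ∑ ω, q ω = 1)
    (hdeg : IsDegraded q) :
    ∑ l, condEntropy q (fun ω => ω.1 l) (fun ω => (past l ω, ω.2 l)) ∈
      singleChannelRates q symbolError 0 := by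
  obtain ⟨ω₀⟩ : Nonempty ((∀ l, W l) × (∀ l, Y l)) := by
    by_contra h
    rw [not_nonempty_iff] at h
    simp at hq1
  have : Nonempty (∀ k, W k) := ⟨ω₀.1⟩
  set h : Fin t → ℝ := fun l => condEntropy q (fun ω => ω.1 l) (fun ω => (past l ω, ω.2 l))
  have h0 : ∀ l, 0 ≤ h l := fun l => condEntropy_nonneg hq _ _
  have hs0 : 0 ≤ ∑ l, h l := Finset.sum_nonneg fun l _ => h0 l
  refine ⟨hs0, fun l => by dsimp only; split_ifs <;> simp [hs0], fun ε hε => ?_⟩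
  obtain ⟨η, hη, hηt⟩ : ∃ η : ℝ, 0 < η ∧ t * (2 * η) ≤ ε / 2 := by
    -- Half of `ε` pays for the rate excess `2 * η` of each component, the other half for the
    -- rounding term `t / n`.
    refine ⟨ε / (4 * (t + 1)), by positivity, ?_⟩
    rw [← mul_div_assoc, ← mul_div_assoc, div_le_div_iff₀ (by positivity) two_pos]
    nlinarith
  have htail := fun k => hdeg.exists_tail_bound_srcCond hq hq1 (lt_add_of_pos_right (h k) hη)
  choose ρ hρ0 hρ1 hρ using htail
  have hlim : Tendsto (fun n : ℕ => ∑ k : Fin t, (∑ l, ρ k l ^ n + t * ((2 : ℝ) ^ (-η)) ^ n))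
      atTop (𝓝 0) := by
    have h1 : Tendsto (fun n : ℕ => ((2 : ℝ) ^ (-η)) ^ n) atTop (𝓝 0) :=
      tendsto_pow_atTop_nhds_zero_of_lt_one (by positivity)
        (Real.rpow_lt_one_of_one_lt_of_neg one_lt_two (by linarith))
    have h2 : Tendsto (fun n : ℕ => ∑ k : Fin t, (∑ l, ρ k l ^ n + t * ((2 : ℝ) ^ (-η)) ^ n))
        atTop (𝓝 (∑ k : Fin t, (∑ l : Fin t, 0 + (t : ℝ) * 0))) :=
      tendsto_finsetSum _ fun k _ => (tendsto_finsetSum _ fun l _ =>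
        tendsto_pow_atTop_nhds_zero_of_lt_one (hρ0 k l) (hρ1 k l)).add (h1.const_mul _)
    simpa using h2
  have hlim2 : Tendsto (fun n : ℕ => (t : ℝ) / n) atTop (𝓝 0) :=
    tendsto_const_div_atTop_nhds_zero_nat _
  obtain ⟨n, hn, hn1, hn2⟩ := ((eventually_gt_atTop 0).and
    ((hlim.eventually_le_const hε).and (hlim2.eventually_le_const (half_pos hε)))).exists
  have hn' : (0 : ℝ) < n := by exact_mod_cast hn
  choose f hf using fun k => exists_binning_isLikely hq hq1 n (h k + η) η k
  obtain ⟨c, hm, hd⟩ := exists_binning_code hq hn (fun k => h k + η) f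
  refine ⟨n, hn, c, fun l => ?_, fun l => ?_⟩
  · rw [Pi.zero_apply, zero_add]
    refine ((hd l).trans ?_).trans hn1
    refine (Finset.sum_le_sum (g := fun k => ∑ l, ρ k l ^ n + t * ((2 : ℝ) ^ (-η)) ^ n)
      fun k hk => ?_).trans
      (Finset.sum_le_univ_sum_of_nonneg fun k => add_nonneg
        (Finset.sum_nonneg fun l _ => pow_nonneg (hρ0 k l) n) (by positivity))
    refine (sum_isAmbiguous_le hq (h k + η) k l (f k)).trans (add_le_add ?_ (hf k l))
    exact (hρ k l (Finset.mem_filter.1 hk).2 n).trans (Finset.single_le_sum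
      (f := fun l => ρ k l ^ n) (fun l _ => pow_nonneg (hρ0 k l) n) (Finset.mem_univ l))
  · dsimp only
    rw [Code.rate, hm]
    split_ifs with hl
    · have := sum_rate_le hn h0 hη
      linarith
    · simp [hε.le]

end Achievability

end SideInfo

end

theorem corollary4 {t : ℕ} {W Y : Fin t → Type*} [∀ l, Fintype (W l)] [∀ l, Fintype (Y l)]
    (q : (∀ l, W l) × (∀ l, Y l) → ℝ) (hq : q ∈ stdSimplex ℝ ((∀ l, W l) × (∀ l, Y l)))
    (hdeg : SideInfo.IsDegraded q) :
    IsLeast (SideInfo.singleChannelRates q SideInfo.symbolError 0)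
        (SideInfo.rateDistortion q SideInfo.symbolError 0) ∧
      SideInfo.rateDistortion q SideInfo.symbolError 0 =
        ∑ l : Fin t, SideInfo.condEntropy q (fun ω => ω.1 l)
          (fun ω => ((fun k : {k : Fin t // k < l} => ω.1 k), ω.2 l)) := by
  have h : IsLeast (SideInfo.singleChannelRates q SideInfo.symbolError 0)
      (∑ l : Fin t, SideInfo.condEntropy q (fun ω => ω.1 l)
        (fun ω => ((fun k : {k : Fin t // k < l} => ω.1 k), ω.2 l))) :=
    ⟨hdeg.sum_condEntropy_mem hq.1 hq.2, fun _ hr => hdeg.sum_condEntropy_le hq.1 hq.2 hr⟩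
  have e : SideInfo.rateDistortion q SideInfo.symbolError 0 = _ := h.csInf_eq
  exact ⟨e ▸ h, e⟩
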